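/- Let $H$ be a (real or complex) Hilbert space, let $(\psi_j)_{j\ge 1}$ be a frame for $H$ with frame bounds $A,B>0$, i.e. $A\|f\|^2\le\sum_{j\ge1}|\langle f,\psi_j\rangle|^2\le B\|f\|^2$ for all $f\in H$, and let $(\phi_j)_{j\ge 1}$ be another frame for $H$. For $n,m\in\mathbb N$ put $G_n=\operatorname{span}\{\phi_1,\dots,\phi_n\}$, let $Q_n$ be the orthogonal projection of $H$ onto $G_n$, let $S_mf=\sum_{j=1}^m\langle f,\psi_j\rangle\psi_j$, and let $W_n=Q_nS_m|_{G_n}:G_n\to G_n$ (it depends on $m$). Let $\Phi_n=[\langle\phi_j,\phi_l\rangle]_{j,l=1}^n$, and let $\lambda_{\min}(\Phi_n)$ be its smallest eigenvalue if $\Phi_n$ is invertible. If $\Phi_n$ is not invertible, $\Phi_n$ is replaced in the formula for $m$ below by any nonempty invertible principal submatrix of it whose rows $I\subset\{1,\dots,n\}$ satisfy $\operatorname{span}\{\phi_j:j\in I\}=G_n$ (no claim is made when $G_n=\{0\}$). Assume that, for some $c_1$ and some $s>1/2$, $$|\langle\psi_j,\phi_l\rangle|\le c_1(1+|j-l|)^{-s}\qquad(j,l\ge1),$$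 and for $n\ge1$ let $m$ be the number $$n+\Bigl[\frac{2c_1^2\,n}{A(2s-1)\lambda_{\min}(\Phi_n)}\Bigr]^{1/(2s-1)}$$ rounded down to an integer, or any larger integer (in particular this number rounded up). (1) For all such $n$ and $m$, the operator $W_n$ is invertible on $G_n$ and $\|W_n^{-1}\|\le 2/A$. (2) Suppose in addition that $|\langle\phi_j,\phi_l\rangle|\le c_0(1+|j-l|)^{-t}$ for all $j,l\ge1$, with some constant $c_0$ and some $t>1$. Then for every $c_2>0$ there is a constant $c>0$ such that for every $f\in H$ with $|\langle f,\phi_j\rangle|\le c_2\,j^{-t}$ for all $j\ge1$, the reconstruction $f_{n,m}=W_n^{-1}Q_nS_mf$ satisfies $$\|f-f_{n,m}\|\le c\,n^{-(t-1/2)}$$ for all such $n$ and $m$. -/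

import Mathlib

/-!
Conventions. Sequences are indexed from `0`: the vector `v j` is the member of index `j + 1` of the
sequence `v_1, v_2, …`. The pairing `⟨f, g⟩`, linear in `f`, is Mathlib's `inner 𝕜 g f`.
-/

namespace FrameRec

section Definitions

variable {𝕜 H : Type*} [RCLike 𝕜] [NormedAddCommGroup H] [InnerProductSpace 𝕜 H]

variable (𝕜) in
/-- `v` is a frame for `H` with frame bounds `A` and `B`. -/
def IsFrame (v : ℕ → H) (A B : ℝ) : Prop :=
  0 < A ∧ 0 < B ∧ ∀ f : H,
    Summable (fun j => ‖inner 𝕜 (v j) f‖ ^ 2) ∧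
    A * ‖f‖ ^ 2 ≤ ∑' j, ‖inner 𝕜 (v j) f‖ ^ 2 ∧
    ∑' j, ‖inner 𝕜 (v j) f‖ ^ 2 ≤ B * ‖f‖ ^ 2

variable (𝕜) in
/-- Localization of `v` with respect to `w` with constant `c` and rate `s`:
`|⟨v_j, w_l⟩| ≤ c (1 + |j - l|)^(-s)` for all `j, l`. Self-localization is the case `v = w`. -/
def IsLocalized (v w : ℕ → H) (c s : ℝ) : Prop :=
  ∀ j l : ℕ, ‖inner 𝕜 (w l) (v j)‖ ≤ c * (1 + |(j : ℝ) - (l : ℝ)|) ^ (-s)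

variable (𝕜) in
/-- `G_n = span {φ_1, …, φ_n}`. -/
def G (φ : ℕ → H) (n : ℕ) : Submodule 𝕜 H := Submodule.span 𝕜 (φ '' {i | i < n})

instance finiteDimensional_G (φ : ℕ → H) (n : ℕ) : FiniteDimensional 𝕜 (G 𝕜 φ n) :=
  FiniteDimensional.span_of_finite 𝕜 ((Set.finite_lt_nat n).image φ)

instance completeSpace_G (φ : ℕ → H) (n : ℕ) : CompleteSpace (G 𝕜 φ n) :=
  FiniteDimensional.complete 𝕜 (G 𝕜 φ n)

variable (𝕜) in
/-- `S_m f = ∑_{j = 1}^m ⟨f, ψ_j⟩ ψ_j`. -/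
noncomputable def S (ψ : ℕ → H) (m : ℕ) : H →L[𝕜] H :=
  ∑ j ∈ Finset.range m, (innerSL 𝕜 (ψ j)).smulRight (ψ j)

theorem S_apply (ψ : ℕ → H) (m : ℕ) (f : H) :
    S 𝕜 ψ m f = ∑ j ∈ Finset.range m, inner 𝕜 (ψ j) f • ψ j := by
  simp [S]

variable (𝕜) in
/-- `Q_n`, the orthogonal projection of `H` onto `G_n`. -/
noncomputable def Q (φ : ℕ → H) (n : ℕ) : H →L[𝕜] G 𝕜 φ n :=
  (G 𝕜 φ n).orthogonalProjectionOnto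

variable (𝕜) in
/-- `W_n`, the restriction of `Q_n S_m` to `G_n`. -/
noncomputable def W (ψ φ : ℕ → H) (n m : ℕ) : G 𝕜 φ n →L[𝕜] G 𝕜 φ n :=
  (Q 𝕜 φ n).comp ((S 𝕜 ψ m).comp (G 𝕜 φ n).subtypeL)

variable (𝕜) in
/-- The reconstruction `f_{n,m} = W_n⁻¹ Q_n S_m f`. -/
noncomputable def recon (ψ φ : ℕ → H) (n m : ℕ) (f : H) : H :=
  ((W 𝕜 ψ φ n m).inverse (Q 𝕜 φ n (S 𝕜 ψ m f)) : G 𝕜 φ n)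

variable (𝕜) in
/-- The Gram matrix of the vectors `φ_j` with index in `I` (its transpose has the same eigenvalues).
For `I = {1, …, n}` it is `Φ_n`; in general it is a principal submatrix of `Φ_n`. -/
noncomputable def gramOn (φ : ℕ → H) (I : Finset ℕ) : Matrix I I 𝕜 :=
  Matrix.gram 𝕜 (fun i : I => φ i)

theorem isHermitian_gramOn (φ : ℕ → H) (I : Finset ℕ) : (gramOn 𝕜 φ I).IsHermitian :=
  Matrix.isHermitian_gram 𝕜 _

variable (𝕜) in
/-- The smallest eigenvalue of the Gram matrix of `(φ_j)`, `j ∈ I`, for a nonempty set `I`. -/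
noncomputable def lambdaMin (φ : ℕ → H) (I : Finset ℕ) : ℝ :=
  ⨅ i, (isHermitian_gramOn (𝕜 := 𝕜) φ I).eigenvalues i

variable (𝕜) in
/-- `I` is a nonempty set of indices among the first `n` for which the principal submatrix of `Φ_n`
on `I` is invertible and of full rank in `Φ_n`, that is, the `φ_j` with `j ∈ I` still span `G_n`.
When `Φ_n` is invertible and `n ≥ 1`, the set of all the first `n` indices is the one such `I`. -/
def IsGramBasis (φ : ℕ → H) (n : ℕ) (I : Finset ℕ) : Prop :=
  I.Nonempty ∧ I ⊆ Finset.range n ∧ IsUnit (gramOn 𝕜 φ I) ∧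
    Submodule.span 𝕜 (φ '' (I : Set ℕ)) = G 𝕜 φ n

variable (𝕜) in
/-- The real number `n + [2 c₁² n / (A (2s - 1) λ_min)]^(1 / (2s - 1))`. -/
noncomputable def sampleNumber (φ : ℕ → H) (I : Finset ℕ) (A c₁ s : ℝ) (n : ℕ) : ℝ :=
  n + (2 * c₁ ^ 2 * n / (A * (2 * s - 1) * lambdaMin 𝕜 φ I)) ^ (1 / (2 * s - 1))

end Definitions

end FrameRec

/-!
# Localized frames: stable reconstruction from finitely many samples

*Stability.* On `G_n` the quadratic form of `W_n` is the sum of the first `m` squared frame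
coefficients. Writing `g ∈ G_n` in the basis `φ_i`, `i ∈ I`, with coefficients of size at most
`‖g‖ / √λ_min`, the localization and an integral comparison bound the remaining coefficients by
`A / 2 * ‖g‖ ^ 2` (`half_lower_bound`). So `W_n` is coercive with constant `A / 2`.

*Rate.* Stability makes the reconstruction quasi-optimal (`norm_sub_recon_le`), which leaves a
question of approximation from `G_n`. If `T` is the frame operator of `φ`, then `f` is the sum of
the `⟨T⁻¹ f, φ_j⟩ φ_j`, and truncating this sum gives the rate as soon as `T⁻¹` preserves the decay
`j ^ (-t)` of coefficients (`exists_inverse_preservesDecay`). This is an instance of Jaffard's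
theorem for the Moore–Penrose inverse of the Gram matrix, proved directly on operators `X` of `H`
through their matrices `⟨X φ_l, φ_j⟩`; the matrix product then corresponds to `X T Y`.

* Interpolating between the operator norm and the decay bound gives a product rule in which the
  decay constant enters a square with a power less than `2` (`MatrixDecay.sq_of_norm_le`). Hence the
  powers `X T X ⋯ T X` have decay constants that grow at most like powers of twice a bound for the
  operator norm, up to a constant factor (`exists_matrixDecay_pow`).
* The Neumann series of `T = α⁻¹ (1 - U)` cannot be used as it stands: as a matrix, `U` is the
  identity on the kernel of the Gram matrix, so its powers do not have small decay constants. With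
  `W = U ^ n` small, however, `W (1 - W)` is of the form `X T` with `X` small, and `(1 - W)⁻¹` is
  the Catalan series in `W (1 - W)` (`one_sub_mul_tsum_catalan`). Multiplied by
  `α (1 + U + ⋯ + U ^ (n - 1))`, it is `T⁻¹`.
-/

namespace FrameRec

/-! ### Polynomially decaying kernels -/

/-- The kernel `(1 + |j - k|)^(-p)` on the index set. -/
noncomputable def decay (p : ℝ) (j k : ℕ) : ℝ := (1 + |(j : ℝ) - (k : ℝ)|) ^ (-p)

theorem decay_pos (p : ℝ) (j k : ℕ) : 0 < decay p j k := by
  unfold decay; positivity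

theorem decay_comm (p : ℝ) (j k : ℕ) : decay p j k = decay p k j := by
  simp only [decay, abs_sub_comm]

theorem decay_zero_right (p : ℝ) (j : ℕ) : decay p j 0 = ((j : ℝ) + 1) ^ (-p) := by
  simp [decay, add_comm]

theorem decay_rpow (p τ : ℝ) (j k : ℕ) : decay p j k ^ τ = decay (p * τ) j k := by
  unfold decay
  rw [← Real.rpow_mul (by positivity), neg_mul]

/-- A bound for all the row sums of `decay p`: the sum of `(1 + |z|)^(-p)` over the integers. -/
noncomputable def decaySum (p : ℝ) : ℝ := ∑' z : ℤ, (1 + |(z : ℝ)|) ^ (-p)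

theorem summable_int_decay {p : ℝ} (hp : 1 < p) :
    Summable fun z : ℤ => (1 + |(z : ℝ)|) ^ (-p) := by
  have h : Summable fun n : ℕ => (1 + (n : ℝ)) ^ (-p) := by
    have := (summable_nat_add_iff 1).2 (Real.summable_nat_rpow.2 (neg_lt_neg hp))
    refine this.congr fun n => ?_
    push_cast
    rw [add_comm]
  refine Summable.of_nat_of_neg ?_ ?_ <;> simpa using h

theorem decaySum_pos {p : ℝ} (hp : 1 < p) : 0 < decaySum p :=
  (summable_int_decay hp).tsum_pos (fun z => by positivity) 0 (by simp)

theorem injective_int_sub (j : ℕ) : Function.Injective fun k : ℕ => (j : ℤ) - k := by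
  intro a b h
  simpa using h

theorem summable_decay {p : ℝ} (hp : 1 < p) (j : ℕ) : Summable fun k => decay p j k := by
  have := (summable_int_decay hp).comp_injective (injective_int_sub j)
  simpa [Function.comp_def, decay] using this

theorem tsum_decay_le {p : ℝ} (hp : 1 < p) (j : ℕ) : ∑' k, decay p j k ≤ decaySum p := by
  have := tsum_comp_le_tsum_of_inj (summable_int_decay hp) (fun z => by positivity)
    (injective_int_sub j)
  simpa [Function.comp_def, decay, decaySum] using this

/-- One of the indices `j`, `l` is at least half as far from `k` as they are from each other. -/
theorem decay_le_or {t : ℝ} (ht : 0 ≤ t) (j k l : ℕ) :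
    decay t j k ≤ 2 ^ t * decay t j l ∨ decay t k l ≤ 2 ^ t * decay t j l := by
  have key : ∀ x y : ℝ, 0 ≤ x → 0 ≤ y → y ≤ 2 * x →
      (1 + x) ^ (-t) ≤ 2 ^ t * (1 + y) ^ (-t) := by
    intro x y hx hy hxy
    have h2 : (2 : ℝ) ^ t = (1 / 2) ^ (-t) := by
      rw [one_div, Real.inv_rpow (by norm_num), Real.rpow_neg (by norm_num), inv_inv]
    rw [h2, ← Real.mul_rpow (by norm_num) (by positivity)]
    exact Real.rpow_le_rpow_of_nonpos (by positivity) (by linarith) (by linarith)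
  have h3 := abs_sub_le (j : ℝ) k l
  rcases le_total |(j : ℝ) - k| |(k : ℝ) - l| with h | h
  · exact .inr (key _ _ (abs_nonneg _) (abs_nonneg _) (by linarith))
  · exact .inl (key _ _ (abs_nonneg _) (abs_nonneg _) (by linarith))

/-- A product of two decaying factors is handled by putting the full decay `t` on the factor with
the far indices and only the summable decay `p` on the other. -/
theorem mul_le_decay {t p N M N' M' u w : ℝ} (ht : 0 ≤ t) (j k l : ℕ) (hN : 0 ≤ N) (hM : 0 ≤ M)
    (hN' : 0 ≤ N') (hM' : 0 ≤ M') (hw : 0 ≤ w)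
    (huN : u ≤ N * decay t j k) (huM : u ≤ M * decay p j k)
    (hwN : w ≤ N' * decay t k l) (hwM : w ≤ M' * decay p k l) :
    u * w ≤ 2 ^ t * decay t j l * (N * M' * decay p l k + N' * M * decay p j k) := by
  have d1 := decay_pos t j l
  have d2 := decay_pos p l k
  have d3 := decay_pos p j k
  have e : (0 : ℝ) < 2 ^ t := by positivity
  rw [decay_comm p k l] at hwM
  rcases decay_le_or ht j k l with h | h
  · calc u * w ≤ (N * (2 ^ t * decay t j l)) * (M' * decay p l k) := by
          gcongr
          exact huN.trans (by gcongr)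
      _ = 2 ^ t * decay t j l * (N * M' * decay p l k) := by ring
      _ ≤ _ := by gcongr; linarith [show 0 ≤ N' * M * decay p j k by positivity]
  · calc u * w ≤ (M * decay p j k) * (N' * (2 ^ t * decay t j l)) := by
          gcongr
          exact hwN.trans (by gcongr)
      _ = 2 ^ t * decay t j l * (N' * M * decay p j k) := by ring
      _ ≤ _ := by gcongr; linarith [show 0 ≤ N * M' * decay p l k by positivity]

/-- The matrix product of two decaying matrices decays, entrywise and quantitatively. -/
theorem norm_le_decay_of_hasSum {E : Type*} [NormedAddCommGroup E] {t p N M N' M' : ℝ}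
    (ht : 0 ≤ t) (hp : 1 < p) (j l : ℕ) (hN : 0 ≤ N) (hM : 0 ≤ M)
    (hN' : 0 ≤ N') (hM' : 0 ≤ M') {u w : ℕ → ℝ} {f : ℕ → E} {a : E} (hf : HasSum f a)
    (hfu : ∀ k, ‖f k‖ ≤ u k * w k) (hw : ∀ k, 0 ≤ w k)
    (huN : ∀ k, u k ≤ N * decay t j k) (huM : ∀ k, u k ≤ M * decay p j k)
    (hwN : ∀ k, w k ≤ N' * decay t k l) (hwM : ∀ k, w k ≤ M' * decay p k l) :
    ‖a‖ ≤ 2 ^ t * decaySum p * (N * M' + N' * M) * decay t j l := by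
  have s := ((((summable_decay hp l).hasSum.mul_left (N * M')).add
    ((summable_decay hp j).hasSum.mul_left (N' * M))).mul_left (2 ^ t * decay t j l))
  refine (hf.norm_le_of_bounded s fun k => (hfu k).trans
    (mul_le_decay ht j k l hN hM hN' hM' (hw k) (huN k) (huM k) (hwN k) (hwM k))).trans ?_
  have h1 := tsum_decay_le hp l
  have h2 := tsum_decay_le hp j
  have d1 := decay_pos t j l
  calc _ ≤ 2 ^ t * decay t j l * (N * M' * decaySum p + N' * M * decaySum p) := by gcongr
    _ = _ := by ring

/-- Interpolation between a uniform bound and a decay bound. -/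
theorem le_interpolate {t τ e ν u : ℝ} (hτ : 0 ≤ τ) (hτ1 : τ ≤ 1) (he : 0 ≤ e) (hν : 0 ≤ ν)
    (hu : 0 ≤ u) (j k : ℕ) (h1 : u ≤ e) (h2 : u ≤ ν * e * decay t j k) :
    u ≤ e * ν ^ τ * decay (t * τ) j k := by
  have d := decay_pos t j k
  calc u = u ^ (1 - τ) * u ^ τ := by
        rw [← Real.rpow_add' hu (by norm_num)]; simp
    _ ≤ e ^ (1 - τ) * (ν * e * decay t j k) ^ τ := by gcongr
    _ = (e ^ (1 - τ) * e ^ τ) * ν ^ τ * decay (t * τ) j k := by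
        rw [Real.mul_rpow (by positivity) d.le, Real.mul_rpow hν he, decay_rpow]; ring
    _ = _ := by rw [← Real.rpow_add' he (by norm_num)]; simp

/-- The integral comparison for a tail of a convergent power sum. -/
theorem sum_rpow_neg_le {x p : ℝ} (hx : 0 < x) (hp : 1 < p) (N : ℕ) :
    ∑ i ∈ Finset.range N, (x + (i + 1 : ℕ)) ^ (-p) ≤ x ^ (1 - p) / (p - 1) := by
  have hanti : AntitoneOn (fun y : ℝ => y ^ (-p)) (Set.Icc x (x + N)) := by
    intro a ha b hb hab
    exact Real.rpow_le_rpow_of_nonpos (hx.trans_le ha.1) hab (by linarith)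
  refine hanti.sum_le_integral.trans ?_
  have h0 : (0 : ℝ) ∉ Set.uIcc x (x + N) := by
    rw [Set.uIcc_of_le (by simp)]
    exact fun h => hx.not_ge h.1
  rw [integral_rpow (.inr ⟨by linarith, h0⟩)]
  have h1 : -p + 1 = -(p - 1) := by ring
  have h2 : 1 - p = -(p - 1) := by ring
  rw [h1, h2, div_neg, neg_div', div_le_div_iff_of_pos_right (by linarith)]
  have : 0 ≤ (x + N) ^ (-(p - 1)) := by positivity
  linarith

theorem summable_rpow_neg {x p : ℝ} (hx : 0 < x) (hp : 1 < p) :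
    Summable fun i : ℕ => (x + (i + 1 : ℕ)) ^ (-p) :=
  summable_of_sum_range_le (fun _ => by positivity) (sum_rpow_neg_le hx hp)

theorem tsum_rpow_neg_le {x p : ℝ} (hx : 0 < x) (hp : 1 < p) :
    ∑' i : ℕ, (x + (i + 1 : ℕ)) ^ (-p) ≤ x ^ (1 - p) / (p - 1) :=
  Real.tsum_le_of_sum_range_le (fun _ => by positivity) (sum_rpow_neg_le hx hp)

/-! ### The Catalan series -/

theorem catalan_le_four_pow (n : ℕ) : catalan n ≤ 4 ^ n := by
  rw [catalan_eq_centralBinom_div]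
  exact (Nat.div_le_self _ _).trans n.centralBinom_le_four_pow

section Catalan

variable (𝕜 : Type*) {R : Type*} [RCLike 𝕜] [NormedRing R] [NormOneClass R] [NormedAlgebra 𝕜 R]

theorem norm_catalan_term_le (y : R) (hy : ‖y‖ ≤ 1 / 8) (n : ℕ) :
    ‖(catalan n : 𝕜) • y ^ n‖ ≤ (1 / 2) ^ n := by
  rw [norm_smul, RCLike.norm_natCast]
  calc (catalan n : ℝ) * ‖y ^ n‖ ≤ 4 ^ n * (1 / 8) ^ n := by
        gcongr
        · exact_mod_cast catalan_le_four_pow n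
        · exact (norm_pow_le y n).trans (by gcongr)
    _ = (1 / 2) ^ n := by rw [← mul_pow]; norm_num

/-- The generating function `F` of the Catalan numbers solves `F = 1 + y F ^ 2`; at `y = w (1 - w)`
with `w` small, this solution is the inverse of `1 - w`. -/
theorem one_sub_mul_tsum_catalan [CompleteSpace R] (w : R)
    (hw : ‖w‖ ≤ 1 / 16) :
    Summable (fun n => (catalan n : 𝕜) • (w * (1 - w)) ^ n) ∧
      (1 - w) * ∑' n, (catalan n : 𝕜) • (w * (1 - w)) ^ n = 1 := by
  set y := w * (1 - w) with hydef
  have hy : ‖y‖ ≤ 1 / 8 := by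
    have h1 : ‖1 - w‖ ≤ 1 + 1 / 16 := (norm_sub_le _ _).trans (by rw [norm_one]; linarith)
    calc ‖y‖ ≤ 1 / 16 * (1 + 1 / 16) := (norm_mul_le _ _).trans (by gcongr)
      _ ≤ 1 / 8 := by norm_num
  have hb := norm_catalan_term_le 𝕜 y hy
  have hg : Summable fun n : ℕ => (1 / 2 : ℝ) ^ n :=
    summable_geometric_of_lt_one (by norm_num) (by norm_num)
  have hsn : Summable fun n => ‖(catalan n : 𝕜) • y ^ n‖ :=
    Summable.of_nonneg_of_le (fun _ => norm_nonneg _) hb hg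
  have hs := hsn.of_norm
  refine ⟨hs, ?_⟩
  set F := ∑' n, (catalan n : 𝕜) • y ^ n with hF
  have hFn : ‖F‖ ≤ 2 := by
    have := tsum_of_norm_bounded hasSum_geometric_two hb
    simpa using this
  have hfix : F = 1 + y * (F * F) := by
    have hmul := tsum_mul_tsum_eq_tsum_sum_antidiagonal_of_summable_norm hsn hsn
    have hsum : ∀ n, ∑ kl ∈ Finset.HasAntidiagonal.antidiagonal n,
        (catalan kl.1 : 𝕜) • y ^ kl.1 * (catalan kl.2 : 𝕜) • y ^ kl.2
        = (catalan (n + 1) : 𝕜) • y ^ n := by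
      intro n
      rw [catalan_succ', Nat.cast_sum, Finset.sum_smul]
      refine Finset.sum_congr rfl fun kl hkl => ?_
      rw [smul_mul_smul_comm, ← pow_add, Finset.HasAntidiagonal.mem_antidiagonal.1 hkl, Nat.cast_mul]
    simp_rw [hsum] at hmul
    have hsum2 : Summable fun n => (catalan (n + 1) : 𝕜) • y ^ n := by
      have := summable_norm_sum_mul_antidiagonal_of_summable_norm hsn hsn
      simp_rw [hsum] at this
      exact this.of_norm
    rw [hmul, ← hsum2.tsum_mul_left, hF, hs.tsum_eq_zero_add]
    simp [pow_succ']
  have hc : Commute w F := by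
    refine Commute.tsum_right _ fun n => (Commute.pow_right ?_ n).smul_right _
    rw [hydef]
    exact (Commute.refl w).mul_right ((Commute.one_right w).sub_right (Commute.refl w))
  have hunit : IsUnit (1 - w * F) := by
    refine isUnit_one_sub_of_norm_lt_one ?_
    calc ‖w * F‖ ≤ 1 / 16 * 2 := (norm_mul_le _ _).trans (by gcongr)
      _ < 1 := by norm_num
  -- `1 - w` and `w` are the two roots of `y = x (1 - x)`, so `1 - F + y F ^ 2` factors.
  have hfac : (1 - (1 - w) * F) * (1 - w * F) = 0 := by
    have h1 : F * w = w * F := hc.eq.symm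
    calc (1 - (1 - w) * F) * (1 - w * F)
        = 1 - F + ((F * w) * F - w * (F * w) * F) := by noncomm_ring
      _ = 1 - F + y * (F * F) := by rw [h1, hydef]; noncomm_ring
      _ = 0 := by nth_rewrite 1 [hfix]; abel
  have := hunit.mul_left_eq_zero.1 hfac
  exact (sub_eq_zero.1 this).symm

end Catalan

/-! ### Frames and their operators -/

section Frame

variable {𝕜 H : Type*} [RCLike 𝕜] [NormedAddCommGroup H] [InnerProductSpace 𝕜 H]

theorem norm_le_of_forall_inner {z : H} {c : ℝ} (hc : 0 ≤ c)
    (h : ∀ y : H, ‖inner 𝕜 y z‖ ≤ c * ‖y‖) :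
    ‖z‖ ≤ c := by
  by_cases hz : z = 0
  · simpa [hz] using hc
  · have h0 : 0 < ‖z‖ := norm_pos_iff.2 hz
    have := h z
    rw [inner_self_eq_norm_sq_to_K, norm_pow, RCLike.norm_ofReal, abs_norm, sq] at this
    exact le_of_mul_le_mul_right this h0

namespace IsFrame

variable {v : ℕ → H} {A B : ℝ} (h : IsFrame 𝕜 v A B)
include h

theorem norm_sq_le (j : ℕ) : ‖v j‖ ^ 2 ≤ B := by
  have h1 := ((h.2.2 (v j)).1.le_tsum j fun _ _ => by positivity).trans (h.2.2 (v j)).2.2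
  rw [inner_self_eq_norm_sq_to_K, norm_pow, RCLike.norm_ofReal, abs_norm] at h1
  by_cases h0 : ‖v j‖ = 0
  · rw [h0]; simpa using h.2.1.le
  · have : 0 < ‖v j‖ ^ 2 := by positivity
    nlinarith

/-- The Bessel inequality, polarized, for any part of the index set. -/
theorem sum_mul_le (s : Finset ℕ) (x y : H) :
    ∑ j ∈ s, ‖inner 𝕜 (v j) x‖ * ‖inner 𝕜 (v j) y‖ ≤ B * ‖x‖ * ‖y‖ := by
  have hb : ∀ z : H, √(∑ j ∈ s, ‖inner 𝕜 (v j) z‖ ^ 2) ≤ √B * ‖z‖ := by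
    intro z
    rw [← Real.sqrt_sq (norm_nonneg z), ← Real.sqrt_mul h.2.1.le]
    exact Real.sqrt_le_sqrt (((h.2.2 z).1.sum_le_tsum s fun _ _ => by positivity).trans
      (h.2.2 z).2.2)
  calc _ ≤ √(∑ j ∈ s, ‖inner 𝕜 (v j) x‖ ^ 2) * √(∑ j ∈ s, ‖inner 𝕜 (v j) y‖ ^ 2) :=
        Real.sum_mul_le_sqrt_mul_sqrt _ _ _
    _ ≤ (√B * ‖x‖) * (√B * ‖y‖) := by gcongr <;> apply hb
    _ = (√B * √B) * ‖x‖ * ‖y‖ := by ring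
    _ = _ := by rw [Real.mul_self_sqrt h.2.1.le]

theorem norm_S_le (m : ℕ) : ‖S 𝕜 v m‖ ≤ B := by
  refine ContinuousLinearMap.opNorm_le_bound _ h.2.1.le fun x => ?_
  refine norm_le_of_forall_inner (𝕜 := 𝕜) (by have := h.2.1; positivity) fun y => ?_
  rw [S_apply, inner_sum]
  refine (norm_sum_le _ _).trans ((le_of_eq ?_).trans
    ((h.sum_mul_le (Finset.range m) x y).trans_eq (by ring)))
  refine Finset.sum_congr rfl fun j _ => ?_
  rw [inner_smul_right, norm_mul, norm_inner_symm y]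

end IsFrame

/-- The truncated frame operator is positive semidefinite, with quadratic form the partial sum. -/
theorem inner_S_self (v : ℕ → H) (m : ℕ) (x : H) :
    inner 𝕜 x (S 𝕜 v m x) = ((∑ j ∈ Finset.range m, ‖inner 𝕜 (v j) x‖ ^ 2 : ℝ) : 𝕜) := by
  rw [S_apply, inner_sum, RCLike.ofReal_sum]
  refine Finset.sum_congr rfl fun j _ => ?_
  rw [inner_smul_right, ← inner_conj_symm x (v j), RCLike.mul_conj, RCLike.ofReal_pow]

variable (𝕜) in
/-- `T` is the frame operator of `v`: `T x = ∑ j, ⟨x, v j⟩ v j` in the weak sense. -/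
def IsFrameOperator (v : ℕ → H) (T : H →L[𝕜] H) : Prop :=
  ∀ x y : H, HasSum (fun j => inner 𝕜 x (v j) * inner 𝕜 (v j) y) (inner 𝕜 x (T y))

theorem IsFrame.exists_isFrameOperator [CompleteSpace H] {v : ℕ → H} {A B : ℝ}
    (h : IsFrame 𝕜 v A B) : ∃ T : H →L[𝕜] H, IsFrameOperator 𝕜 v T := by
  have hmem : ∀ x : H, Memℓp (fun j => inner 𝕜 (v j) x) 2 := fun x =>
    memℓp_gen (by simpa using (h.2.2 x).1)
  let L : H →ₗ[𝕜] lp (fun _ : ℕ => 𝕜) 2 :=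
    { toFun := fun x => ⟨fun j => inner 𝕜 (v j) x, hmem x⟩
      map_add' := fun x y => by ext j; exact inner_add_right _ _ _
      map_smul' := fun c x => by ext j; simp [inner_smul_right] }
  have hL : ∀ x, ‖L x‖ ≤ √B * ‖x‖ := by
    intro x
    rw [← Real.sqrt_sq (norm_nonneg x), ← Real.sqrt_mul h.2.1.le]
    refine Real.le_sqrt_of_sq_le ?_
    have h1 := lp.norm_rpow_eq_tsum (p := 2) (by norm_num) (L x)
    simp only [ENNReal.toReal_ofNat, Real.rpow_ofNat] at h1
    rw [h1]
    exact (h.2.2 x).2.2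
  let C : H →L[𝕜] lp (fun _ : ℕ => 𝕜) 2 := L.mkContinuous _ hL
  refine ⟨(ContinuousLinearMap.adjoint C).comp C, fun x y => ?_⟩
  have h2 := lp.hasSum_inner (𝕜 := 𝕜) (C x) (C y)
  rw [ContinuousLinearMap.comp_apply, ContinuousLinearMap.adjoint_inner_right]
  refine h2.congr_fun fun j => ?_
  change _ = inner 𝕜 (inner 𝕜 (v j) x) (inner 𝕜 (v j) y)
  rw [RCLike.inner_apply, inner_conj_symm, mul_comm]

namespace IsFrameOperator

variable {v : ℕ → H} {A B : ℝ} {T : H →L[𝕜] H}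

theorem re_inner (hT : IsFrameOperator 𝕜 v T) (x : H) :
    RCLike.re (inner 𝕜 x (T x)) = ∑' j, ‖inner 𝕜 (v j) x‖ ^ 2 := by
  have h1 := (RCLike.reCLM (K := 𝕜)).hasSum (hT x x)
  refine (HasSum.tsum_eq ?_).symm
  refine h1.congr_fun fun j => ?_
  simp only [RCLike.reCLM_apply]
  rw [← inner_conj_symm x (v j), RCLike.conj_mul, ← RCLike.ofReal_pow, RCLike.ofReal_re]

theorem norm_le (hT : IsFrameOperator 𝕜 v T) (h : IsFrame 𝕜 v A B) : ‖T‖ ≤ B := by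
  refine ContinuousLinearMap.opNorm_le_bound _ h.2.1.le fun x => ?_
  refine norm_le_of_forall_inner (𝕜 := 𝕜) (by have := h.2.1; positivity) fun y => ?_
  refine le_of_tendsto (hT y x).norm (Filter.Eventually.of_forall fun s => ?_)
  refine (norm_sum_le _ _).trans ((le_of_eq ?_).trans ((h.sum_mul_le s x y).trans_eq (by ring)))
  refine Finset.sum_congr rfl fun j _ => ?_
  rw [norm_mul, norm_inner_symm y, mul_comm]

/-- A small multiple of the frame operator is a contraction away from the identity. -/
theorem exists_contraction (hT : IsFrameOperator 𝕜 v T) (h : IsFrame 𝕜 v A B) :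
    ∃ α ρ : ℝ, 0 < α ∧ 0 ≤ ρ ∧ ρ < 1 ∧ ‖1 - (α : 𝕜) • T‖ ≤ ρ := by
  have hA := h.1
  have hB := h.2.1
  have hq : A ^ 2 / B ^ 2 > 0 := by positivity
  refine ⟨A / B ^ 2, √(1 - A ^ 2 / B ^ 2), by positivity, by positivity, ?_, ?_⟩
  · rw [Real.sqrt_lt' one_pos]; linarith
  refine ContinuousLinearMap.opNorm_le_bound _ (by positivity) fun x => ?_
  rw [← Real.sqrt_sq (norm_nonneg x), ← Real.sqrt_mul' _ (by positivity)]
  refine Real.le_sqrt_of_sq_le ?_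
  change ‖x - (((A / B ^ 2 : ℝ) : 𝕜) • T x)‖ ^ 2 ≤ _
  rw [@norm_sub_sq 𝕜, inner_smul_right, RCLike.re_ofReal_mul, hT.re_inner, norm_smul,
    RCLike.norm_ofReal, abs_of_pos (by positivity), mul_pow]
  have h1 := (h.2.2 x).2.1
  have h2 : ‖T x‖ ≤ B * ‖x‖ := T.le_of_opNorm_le (hT.norm_le h) x
  have h3 : ‖T x‖ ^ 2 ≤ (B * ‖x‖) ^ 2 := by gcongr
  calc _ ≤ ‖x‖ ^ 2 - 2 * (A / B ^ 2 * (A * ‖x‖ ^ 2)) + (A / B ^ 2) ^ 2 * (B * ‖x‖) ^ 2 := by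
        gcongr
    _ = (1 - A ^ 2 / B ^ 2) * ‖x‖ ^ 2 := by field_simp; ring

/-- Inserting the frame operator between two operators multiplies their matrices. -/
theorem hasSum_matrix [CompleteSpace H] (hT : IsFrameOperator 𝕜 v T) (X : H →L[𝕜] H) (x y : H) :
    HasSum (fun k => inner 𝕜 x (X (v k)) * inner 𝕜 (v k) y) (inner 𝕜 x (X (T y))) := by
  simpa only [ContinuousLinearMap.adjoint_inner_left] using
    hT (ContinuousLinearMap.adjoint X x) y

end IsFrameOperator

end Frame

/-! ### Operators with a decaying matrix -/

section Localized

variable {𝕜 H : Type*} [RCLike 𝕜] [NormedAddCommGroup H] [InnerProductSpace 𝕜 H]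

variable (𝕜) in
/-- The coefficients `⟨f, v j⟩` are bounded by `c (1 + j)^(-t)`. -/
def CoeffDecay (v : ℕ → H) (t : ℝ) (f : H) (c : ℝ) : Prop :=
  ∀ j, ‖inner 𝕜 (v j) f‖ ≤ c * decay t j 0

/-- The matrix `⟨X v l, v j⟩` of `X` is bounded by `N (1 + |j - l|)^(-t)`. -/
def MatrixDecay (v : ℕ → H) (t : ℝ) (X : H →L[𝕜] H) (N : ℝ) : Prop :=
  ∀ j l, ‖inner 𝕜 (v j) (X (v l))‖ ≤ N * decay t j l

/-- `P` maps vectors with coefficients of decay `t` to such vectors, with linear control. -/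
def PreservesDecay (v : ℕ → H) (t : ℝ) (P : H →L[𝕜] H) : Prop :=
  ∃ C : ℝ, 0 ≤ C ∧ ∀ f c, CoeffDecay 𝕜 v t f c → CoeffDecay 𝕜 v t (P f) (C * c)

variable {v : ℕ → H} {t : ℝ} {X Y T : H →L[𝕜] H} {N N' c : ℝ} {f g : H}

namespace CoeffDecay

theorem nonneg (h : CoeffDecay 𝕜 v t f c) : 0 ≤ c :=
  nonneg_of_mul_nonneg_left ((norm_nonneg _).trans (h 0)) (decay_pos t 0 0)

theorem add {c' : ℝ} (hf : CoeffDecay 𝕜 v t f c) (hg : CoeffDecay 𝕜 v t g c') :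
    CoeffDecay 𝕜 v t (f + g) (c + c') := fun j => by
  rw [inner_add_right, add_mul]
  exact (norm_add_le _ _).trans (add_le_add (hf j) (hg j))

theorem smul (a : 𝕜) (hf : CoeffDecay 𝕜 v t f c) : CoeffDecay 𝕜 v t (a • f) (‖a‖ * c) :=
  fun j => by
  rw [inner_smul_right, norm_mul, mul_assoc]
  exact mul_le_mul_of_nonneg_left (hf j) (norm_nonneg _)

end CoeffDecay

namespace PreservesDecay

theorem one : PreservesDecay v t (1 : H →L[𝕜] H) := ⟨1, zero_le_one, fun f c h => by simpa using h⟩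

theorem add (hX : PreservesDecay v t X) (hY : PreservesDecay v t Y) :
    PreservesDecay v t (X + Y) := by
  obtain ⟨C, hC, h⟩ := hX
  obtain ⟨C', hC', h'⟩ := hY
  exact ⟨C + C', add_nonneg hC hC', fun f c hf => by
    rw [add_mul]
    exact (h f c hf).add (h' f c hf)⟩

theorem smul (a : 𝕜) (hX : PreservesDecay v t X) : PreservesDecay v t (a • X) := by
  obtain ⟨C, hC, h⟩ := hX
  exact ⟨‖a‖ * C, by positivity, fun f c hf => by
    rw [mul_assoc]
    exact (h f c hf).smul a⟩

theorem mul (hX : PreservesDecay v t X) (hY : PreservesDecay v t Y) :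
    PreservesDecay v t (X * Y) := by
  obtain ⟨C, hC, h⟩ := hX
  obtain ⟨C', hC', h'⟩ := hY
  exact ⟨C * C', by positivity, fun f c hf => by
    rw [mul_assoc]
    exact h _ _ (h' f c hf)⟩

theorem zero : PreservesDecay v t (0 : H →L[𝕜] H) := by
  simpa using smul (0 : 𝕜) (one (v := v) (t := t))

theorem pow (hX : PreservesDecay v t X) (n : ℕ) : PreservesDecay v t (X ^ n) := by
  induction n with
  | zero => simpa using one
  | succ n ih => rw [pow_succ]; exact ih.mul hX

theorem sum {F : ℕ → H →L[𝕜] H} (h : ∀ i, PreservesDecay v t (F i)) (n : ℕ) :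
    PreservesDecay v t (∑ i ∈ Finset.range n, F i) := by
  induction n with
  | zero => simpa using zero
  | succ n ih => rw [Finset.sum_range_succ]; exact ih.add (h n)

end PreservesDecay

namespace MatrixDecay

theorem nonneg (h : MatrixDecay v t X N) : 0 ≤ N :=
  nonneg_of_mul_nonneg_left ((norm_nonneg _).trans (h 0 0)) (decay_pos t 0 0)

theorem mono (h : MatrixDecay v t X N) (hN : N ≤ N') : MatrixDecay v t X N' := fun j l =>
  (h j l).trans (mul_le_mul_of_nonneg_right hN (decay_pos t j l).le)

theorem add (hX : MatrixDecay v t X N) (hY : MatrixDecay v t Y N') :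
    MatrixDecay v t (X + Y) (N + N') := fun j l => by
  rw [add_apply, inner_add_right, add_mul]
  exact (norm_add_le _ _).trans (add_le_add (hX j l) (hY j l))

theorem smul (a : 𝕜) (hX : MatrixDecay v t X N) : MatrixDecay v t (a • X) (‖a‖ * N) :=
  fun j l => by
  rw [smul_apply, inner_smul_right, norm_mul, mul_assoc]
  exact mul_le_mul_of_nonneg_left (hX j l) (norm_nonneg _)

theorem sum {F : ℕ → H →L[𝕜] H} (h : ∀ i, ∃ N, MatrixDecay v t (F i) N) (n : ℕ) :
    ∃ N, MatrixDecay v t (∑ i ∈ Finset.range n, F i) N := by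
  induction n with
  | zero => exact ⟨0, fun j l => by simp⟩
  | succ n ih =>
    obtain ⟨N, hN⟩ := ih
    obtain ⟨N', hN'⟩ := h n
    rw [Finset.sum_range_succ]
    exact ⟨_, hN.add hN'⟩

variable [CompleteSpace H]

/-- The product rule for decaying matrices, with a weaker exponent `p` of decay for the factor that
is summed. -/
theorem mul_of_two_rates (hT : IsFrameOperator 𝕜 v T) {p M M' : ℝ} (ht : 0 ≤ t) (hp : 1 < p)
    (hX : MatrixDecay v t X N) (hXp : MatrixDecay v p X M)
    (hY : MatrixDecay v t Y N') (hYp : MatrixDecay v p Y M') :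
    MatrixDecay v t (X * T * Y) (2 ^ t * decaySum p * (N * M' + N' * M)) := fun j l =>
  norm_le_decay_of_hasSum ht hp j l hX.nonneg hXp.nonneg hY.nonneg hYp.nonneg
    (hT.hasSum_matrix X (v j) (Y (v l))) (fun _ => (norm_mul _ _).le) (fun _ => norm_nonneg _)
    (fun k => hX j k) (fun k => hXp j k) (fun k => hY k l) (fun k => hYp k l)

theorem mul (hT : IsFrameOperator 𝕜 v T) (ht : 1 < t)
    (hX : MatrixDecay v t X N) (hY : MatrixDecay v t Y N') :
    MatrixDecay v t (X * T * Y) (2 ^ t * decaySum t * 2 * (N * N')) :=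
  (mul_of_two_rates hT (by linarith) ht hX hX hY hY).mono (by ring_nf; rfl)

theorem apply (hT : IsFrameOperator 𝕜 v T) (ht : 1 < t)
    (hX : MatrixDecay v t X N) (hf : CoeffDecay 𝕜 v t f c) :
    CoeffDecay 𝕜 v t (X (T f)) (2 ^ t * decaySum t * 2 * (N * c)) := fun j =>
  (norm_le_decay_of_hasSum (by linarith) ht j 0 hX.nonneg hX.nonneg hf.nonneg hf.nonneg
    (hT.hasSum_matrix X (v j) f) (fun _ => (norm_mul _ _).le) (fun _ => norm_nonneg _)
    (fun k => hX j k) (fun k => hX j k) hf hf).trans_eq (by ring)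

theorem preservesDecay (hT : IsFrameOperator 𝕜 v T) (ht : 1 < t) (hX : MatrixDecay v t X N) :
    PreservesDecay v t (X * T) := by
  have h0 := decaySum_pos ht
  have h1 := hX.nonneg
  exact ⟨2 ^ t * decaySum t * 2 * N, by positivity, fun f c hf => by
    rw [mul_assoc _ N]
    exact hX.apply hT ht hf⟩

/-- Interpolating with the operator norm improves the product rule for a square: with `e`
controlling the operator norm and `ν e` the decay, the factor `ν` enters with a power less
than `2`. -/
theorem sq_of_norm_le (hT : IsFrameOperator 𝕜 v T) {A B τ e ν : ℝ} (hv : IsFrame 𝕜 v A B)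
    (ht : 0 ≤ t) (hτ : 0 ≤ τ) (hτ1 : τ ≤ 1) (htτ : 1 < t * τ) (he : 0 ≤ e) (hν : 0 < ν)
    (hX : MatrixDecay v t X (ν * e)) (hXe : B * ‖X‖ ≤ e) :
    MatrixDecay v t (X * T * X) (2 ^ t * decaySum (t * τ) * 2 * ν ^ (1 + τ) * e ^ 2) := by
  have hentry : ∀ j l, ‖inner 𝕜 (v j) (X (v l))‖ ≤ e := by
    intro j l
    have hb : ∀ i, ‖v i‖ ≤ √B := fun i => Real.le_sqrt_of_sq_le (hv.norm_sq_le i)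
    calc _ ≤ ‖v j‖ * (‖X‖ * ‖v l‖) := (norm_inner_le_norm _ _).trans (by
            gcongr; exact X.le_opNorm _)
      _ ≤ √B * (‖X‖ * √B) := by gcongr <;> apply hb
      _ = (√B * √B) * ‖X‖ := by ring
      _ ≤ e := by rwa [Real.mul_self_sqrt hv.2.1.le]
  have hXp : MatrixDecay v (t * τ) X (e * ν ^ τ) := fun j l =>
    le_interpolate hτ hτ1 he hν.le (norm_nonneg _) j l (hentry j l) (hX j l)
  refine (mul_of_two_rates hT ht htτ hX hXp hX hXp).mono (le_of_eq ?_)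
  rw [Real.rpow_add hν, Real.rpow_one]
  ring

end MatrixDecay

/-- A constant raised to powers `σ ^ i` with `σ < 2` is eventually negligible against `2 ^ 2 ^ i`. -/
theorem exists_mul_rpow_le_two_pow {C K σ : ℝ} (hC : 0 < C) (hK : 0 < K) (hσ : 0 ≤ σ)
    (hσ2 : σ < 2) : ∃ i : ℕ, C * K ^ (σ ^ i) ≤ 2 ^ 2 ^ i := by
  have h1 : Filter.Tendsto (fun i : ℕ => (1 / 2 : ℝ) ^ i * Real.log C + (σ / 2) ^ i * Real.log K)
      Filter.atTop (nhds (0 * Real.log C + 0 * Real.log K)) :=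
    ((tendsto_pow_atTop_nhds_zero_of_lt_one (by norm_num) (by norm_num)).mul_const _).add
      ((tendsto_pow_atTop_nhds_zero_of_lt_one (by positivity) (by linarith)).mul_const _)
  obtain ⟨i, hi⟩ := (h1.eventually_le_const (u := Real.log 2)
    (by simpa using Real.log_pos one_lt_two)).exists
  refine ⟨i, (Real.log_le_log_iff (by positivity) (by positivity)).1 ?_⟩
  rw [Real.log_mul hC.ne' (by positivity), Real.log_rpow hK, Real.log_pow, Nat.cast_pow,
    Nat.cast_ofNat]
  rw [div_pow, div_pow, one_pow] at hi
  have h2 : (0 : ℝ) < 2 ^ i := by positivity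
  calc _ = 2 ^ i * (1 / 2 ^ i * Real.log C + σ ^ i / 2 ^ i * Real.log K) := by field_simp
    _ ≤ _ := by gcongr

variable [CompleteSpace H]

/-- Repeated squaring: the decay bounds of the powers `X T X ⋯ T X` with `2 ^ i` factors `X` exceed
the bounds `e ^ 2 ^ i` from the operator norm by a factor of subexponential growth only. -/
theorem exists_matrixDecay_two_pow (hT : IsFrameOperator 𝕜 v T) {A B e : ℝ}
    (hv : IsFrame 𝕜 v A B) (ht : 1 < t) (he : 0 < e) (hX : MatrixDecay v t X N)
    (hXe : B * ‖X‖ ≤ e) :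
    ∃ K σ : ℝ, 0 < K ∧ 0 ≤ σ ∧ σ < 2 ∧ ∀ i : ℕ,
      MatrixDecay v t ((X * T) ^ (2 ^ i - 1) * X) (K ^ (σ ^ i) * e ^ 2 ^ i) := by
  -- Any exponent `τ < 1` with `t τ > 1` will do.
  obtain ⟨τ, hτ0, hτ1⟩ := exists_between ((div_lt_one (by linarith)).2 ht)
  have hτ : 0 < τ := lt_trans (by positivity) hτ0
  have htτ : 1 < t * τ := by rwa [div_lt_iff₀' (by linarith)] at hτ0
  set δ := (1 - τ) / 2 with hδ
  have hδ0 : 0 < δ := by rw [hδ]; linarith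
  have hds := decaySum_pos htτ
  set C := 2 ^ t * decaySum (t * τ) * 2 with hC
  have hC0 : 0 < C := by positivity
  set K := max 1 (max (C ^ (1 / δ)) (N / e)) with hK
  have hK1 : 1 ≤ K := le_max_left _ _
  have hK0 : 0 < K := by linarith
  have hKC : C ≤ K ^ δ := by
    have : C ^ (1 / δ) ≤ K := (le_max_left _ _).trans (le_max_right _ _)
    calc C = (C ^ (1 / δ)) ^ δ := by
          rw [← Real.rpow_mul hC0.le, one_div_mul_cancel hδ0.ne', Real.rpow_one]
      _ ≤ K ^ δ := by gcongr
  have hKN : N ≤ K * e := by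
    rw [← div_le_iff₀ he]
    exact (le_max_right _ _).trans (le_max_right _ _)
  -- Squaring raises the excess factor to the power `1 + τ`; the surplus `δ` absorbs the constant `C`.
  set σ := 1 + τ + δ with hσ
  have hσ1 : 1 ≤ σ := by rw [hσ]; linarith
  have hTB := hT.norm_le hv
  have hB := hv.2.1
  refine ⟨K, σ, hK0, by linarith, by rw [hσ, hδ]; linarith, fun i => ?_⟩
  refine (?_ : MatrixDecay v t ((X * T) ^ (2 ^ i - 1) * X) (K ^ (σ ^ i) * e ^ 2 ^ i) ∧
    B * ‖(X * T) ^ (2 ^ i - 1) * X‖ ≤ e ^ 2 ^ i).1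
  induction i with
  | zero => simpa using ⟨hX.mono hKN, hXe⟩
  | succ i ih =>
    set Z := (X * T) ^ (2 ^ i - 1) * X with hZ
    have hstep : (X * T) ^ (2 ^ (i + 1) - 1) * X = Z * T * Z := by
      have h1 : 2 ^ (i + 1) - 1 = (2 ^ i - 1) + 1 + (2 ^ i - 1) := by
        have : 1 ≤ 2 ^ i := Nat.one_le_two_pow
        rw [pow_succ]; omega
      rw [h1, pow_add, pow_succ, hZ]
      simp only [mul_assoc]
    rw [hstep]
    have he2 : e ^ 2 ^ (i + 1) = (e ^ 2 ^ i) ^ 2 := by rw [← pow_mul, pow_succ]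
    constructor
    · refine (ih.1.sq_of_norm_le hT hv (by linarith) hτ.le hτ1.le htτ (by positivity)
        (by positivity) ih.2).mono ?_
      rw [he2]
      gcongr
      have h1 : K ^ δ ≤ K ^ (δ * σ ^ i) :=
        Real.rpow_le_rpow_of_exponent_le hK1 (le_mul_of_one_le_right hδ0.le (one_le_pow₀ hσ1))
      calc C * (K ^ σ ^ i) ^ (1 + τ) ≤ K ^ (δ * σ ^ i) * (K ^ σ ^ i) ^ (1 + τ) := by
            gcongr; exact hKC.trans h1
        _ = K ^ (δ * σ ^ i + σ ^ i * (1 + τ)) := by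
            rw [← Real.rpow_mul hK0.le, ← Real.rpow_add hK0]
        _ = K ^ σ ^ (i + 1) := by rw [pow_succ, hσ]; ring_nf
    · calc B * ‖Z * T * Z‖ ≤ B * (‖Z‖ * B * ‖Z‖) := by
            gcongr
            refine (norm_mul_le _ _).trans ?_
            gcongr
            exact (norm_mul_le _ _).trans (by gcongr)
        _ = (B * ‖Z‖) ^ 2 := by ring
        _ ≤ (e ^ 2 ^ i) ^ 2 := by gcongr; exact ih.2
        _ = _ := he2.symm

/-- The decay bounds of all the powers `X T X ⋯ T X` grow at most like the powers of `2 e`. -/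
theorem exists_matrixDecay_pow (hT : IsFrameOperator 𝕜 v T) {A B e : ℝ}
    (hv : IsFrame 𝕜 v A B) (ht : 1 < t) (he : 0 < e) (hX : MatrixDecay v t X N)
    (hXe : B * ‖X‖ ≤ e) :
    ∃ K : ℝ, ∀ k : ℕ, MatrixDecay v t ((X * T) ^ k * X) (K * (2 * e) ^ k) := by
  obtain ⟨K, σ, hK, hσ, hσ2, h⟩ := exists_matrixDecay_two_pow hT hv ht he hX hXe
  have hds := decaySum_pos ht
  set C := 2 ^ t * decaySum t * 2 with hC
  have hC0 : 0 < C := by positivity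
  obtain ⟨i, hi⟩ := exists_mul_rpow_le_two_pow hC0 hK hσ hσ2
  have hex : ∀ k : ℕ, ∃ N, MatrixDecay v t ((X * T) ^ k * X) N := by
    intro k
    induction k with
    | zero => exact ⟨N, by simpa using hX⟩
    | succ k ih =>
      obtain ⟨N', hN'⟩ := ih
      exact ⟨_, by simpa only [pow_succ', mul_assoc] using hX.mul hT ht hN'⟩
  choose n hn using hex
  have hn0 : ∀ k, 0 ≤ n k / (2 * e) ^ k := fun k => div_nonneg (hn k).nonneg (by positivity)
  refine ⟨∑ k ∈ Finset.range (2 ^ i), n k / (2 * e) ^ k, fun k => ?_⟩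
  set K' := ∑ k ∈ Finset.range (2 ^ i), n k / (2 * e) ^ k with hK'
  have hK'0 : 0 ≤ K' := Finset.sum_nonneg fun k _ => hn0 k
  induction k using Nat.strong_induction_on with
  | _ k ih =>
    by_cases hk : k < 2 ^ i
    · refine (hn k).mono ?_
      rw [← div_le_iff₀ (by positivity)]
      exact Finset.single_le_sum (fun k _ => hn0 k) (Finset.mem_range.2 hk)
    · obtain ⟨l, rfl⟩ := Nat.exists_eq_add_of_le (not_lt.1 hk)
      have hq : 0 < 2 ^ i := by positivity
      have h1 := (h i).mul hT ht (ih l (by omega))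
      have h2 : (X * T) ^ (2 ^ i - 1) * X * T * ((X * T) ^ l * X) = (X * T) ^ (2 ^ i + l) * X := by
        rw [pow_add]
        conv_rhs => rw [← Nat.sub_add_cancel hq, pow_succ]
        simp only [mul_assoc]
      rw [h2] at h1
      refine h1.mono ?_
      calc C * (K ^ σ ^ i * e ^ 2 ^ i * (K' * (2 * e) ^ l))
          = (C * K ^ σ ^ i) * e ^ 2 ^ i * (K' * (2 * e) ^ l) := by ring
        _ ≤ 2 ^ 2 ^ i * e ^ 2 ^ i * (K' * (2 * e) ^ l) := by gcongr
        _ = K' * (2 * e) ^ (2 ^ i + l) := by rw [pow_add, mul_pow 2 e (2 ^ i)]; ring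

/-- The Catalan series in `X T` preserves decay when the powers of `X T` have small decay bounds. -/
theorem preservesDecay_tsum_catalan (hT : IsFrameOperator 𝕜 v T) (ht : 1 < t) {K : ℝ}
    (hX : ∀ k : ℕ, MatrixDecay v t ((X * T) ^ k * X) (K * (1 / 8) ^ k))
    (hs : Summable fun n => (catalan n : 𝕜) • (X * T) ^ n) :
    PreservesDecay v t (∑' n, (catalan n : 𝕜) • (X * T) ^ n) := by
  have hds := decaySum_pos ht
  have hK : 0 ≤ K := by simpa using (hX 0).nonneg
  set C := 2 ^ t * decaySum t * 2 with hC
  have hC0 : 0 < C := by positivity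
  refine ⟨2 * (1 + 8 * (C * K)), by positivity, fun f c hf j => ?_⟩
  have hc := hf.nonneg
  have hd := decay_pos t j 0
  have h1 := (innerSL 𝕜 (v j)).hasSum ((ContinuousLinearMap.apply 𝕜 H f).hasSum hs.hasSum)
  have hbound : ∀ n : ℕ, ‖inner 𝕜 (v j) (((catalan n : 𝕜) • (X * T) ^ n) f)‖ ≤
      (1 + 8 * (C * K)) * (c * decay t j 0) * (1 / 2) ^ n := by
    intro n
    rw [smul_apply, inner_smul_right, norm_mul, RCLike.norm_natCast]
    cases n with
    | zero =>
      have := hf j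
      have h2 : 0 ≤ 8 * (C * K) * (c * decay t j 0) := by positivity
      simp only [catalan_zero, Nat.cast_one, pow_zero, one_mul, mul_one,
        one_apply_eq_self]
      linarith
    | succ n =>
      have h2 := (hX n).apply hT ht hf j
      have h3 : (catalan (n + 1) : ℝ) ≤ 4 ^ (n + 1) := by exact_mod_cast catalan_le_four_pow _
      have h4 : ((X * T) ^ (n + 1)) f = ((X * T) ^ n * X) (T f) := by
        rw [pow_succ, ← mul_assoc]; rfl
      rw [h4]
      calc _ ≤ 4 ^ (n + 1) * (C * (K * (1 / 8) ^ n * c) * decay t j 0) := by gcongr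
        _ = 8 * (C * K) * (c * decay t j 0) * (1 / 2) ^ (n + 1) := by
          have : (1 / 8 : ℝ) ^ n = (1 / 4) ^ n * (1 / 2) ^ n := by rw [← mul_pow]; norm_num
          rw [this, one_div_pow 4]
          field_simp
          ring
        _ ≤ _ := by gcongr; linarith
  have h5 := h1.norm_le_of_bounded (hasSum_geometric_two.mul_left _) hbound
  refine (le_of_eq ?_).trans (h5.trans_eq (by ring))
  rfl

/-- The inverse of the frame operator of a self-localized frame preserves decay. -/
theorem exists_inverse_preservesDecay [Nontrivial H] (hT : IsFrameOperator 𝕜 v T) {A B c₀ : ℝ}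
    (hv : IsFrame 𝕜 v A B) (ht : 1 < t) (hloc : MatrixDecay v t (1 : H →L[𝕜] H) c₀) :
    ∃ R : H →L[𝕜] H, T * R = 1 ∧ PreservesDecay v t R := by
  obtain ⟨α, ρ, hα, hρ0, hρ1, hU⟩ := hT.exists_contraction hv
  have hB := hv.2.1
  set U : H →L[𝕜] H := 1 - (α : 𝕜) • T with hUdef
  have hUn : ∀ n : ℕ, ‖U ^ n‖ ≤ ρ ^ n := fun n => (norm_pow_le U n).trans (by gcongr)
  obtain ⟨n, hn1, hn2⟩ : ∃ n : ℕ, ρ ^ n ≤ 1 / 16 ∧ B * α * (n * ρ ^ n) ≤ 1 / 16 := by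
    have h1 := tendsto_pow_atTop_nhds_zero_of_lt_one hρ0 hρ1
    have h2 := (tendsto_self_mul_const_pow_of_lt_one hρ0 hρ1).const_mul (B * α)
    rw [mul_zero] at h2
    exact ((h1.eventually_le_const (by norm_num)).and
      (h2.eventually_le_const (by norm_num))).exists
  set W := U ^ n with hW
  set h := ∑ i ∈ Finset.range n, U ^ i with hh
  have hgeom : h * ((α : 𝕜) • T) = 1 - W := by
    have := geom_sum_mul_neg U n
    rwa [hUdef, sub_sub_cancel, ← hUdef] at this
  have hgeom' : ((α : 𝕜) • T) * h = 1 - W := by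
    have := mul_neg_geom_sum U n
    rwa [hUdef, sub_sub_cancel, ← hUdef] at this
  set X := (α : 𝕜) • (W * h) with hX
  have hXT : X * T = W * (1 - W) := by
    rw [← hgeom, hX, smul_mul_assoc, mul_smul_comm, mul_smul_comm, mul_assoc]
  have hXn : B * ‖X‖ ≤ 1 / 16 := by
    have h1 : ‖h‖ ≤ n := by
      refine (norm_sum_le _ _).trans ?_
      calc _ ≤ ∑ i ∈ Finset.range n, (1 : ℝ) :=
            Finset.sum_le_sum fun i _ => (hUn i).trans (pow_le_one₀ hρ0 hρ1.le)
        _ = n := by simp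
    calc B * ‖X‖ ≤ B * (α * (ρ ^ n * n)) := by
          rw [hX, norm_smul, RCLike.norm_ofReal, abs_of_pos hα]
          gcongr
          exact (norm_mul_le _ _).trans (mul_le_mul (hUn n) h1 (norm_nonneg _) (by positivity))
      _ = B * α * (n * ρ ^ n) := by ring
      _ ≤ 1 / 16 := hn2
  have hUdecay : ∀ i, ∃ N, MatrixDecay v t (U ^ i) N := by
    intro i
    induction i with
    | zero => exact ⟨c₀, by simpa using hloc⟩
    | succ i ih =>
      obtain ⟨N, hN⟩ := ih
      have h1 := hN.add ((hloc.mul hT ht hN).smul (-(α : 𝕜)))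
      refine ⟨_, (?_ : U ^ (i + 1) = U ^ i + -(α : 𝕜) • (1 * T * U ^ i)) ▸ h1⟩
      rw [pow_succ', one_mul]
      nth_rewrite 1 [hUdef]
      rw [sub_mul, one_mul, smul_mul_assoc, neg_smul, sub_eq_add_neg]
  have hXdecay : ∃ N, MatrixDecay v t X N := by
    obtain ⟨N, hN⟩ := MatrixDecay.sum (F := fun i => U ^ (n + i)) (fun i => hUdecay _) n
    have : X = (α : 𝕜) • ∑ i ∈ Finset.range n, U ^ (n + i) := by
      simp only [hX, hh, hW, Finset.mul_sum, pow_add]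
    exact ⟨_, this ▸ hN.smul _⟩
  obtain ⟨N, hN⟩ := hXdecay
  -- The rate `2 / 16 = 1 / 8` beats the growth `4 ^ k` of the Catalan numbers.
  obtain ⟨K, hK⟩ := exists_matrixDecay_pow hT hv ht (e := 1 / 16) (by norm_num) hN hXn
  obtain ⟨hs, hF⟩ := one_sub_mul_tsum_catalan 𝕜 W ((hUn n).trans hn1)
  rw [← hXT] at hs hF
  norm_num only at hK
  have hFdecay := preservesDecay_tsum_catalan hT ht hK hs
  have hTdecay : PreservesDecay v t T := by simpa using hloc.preservesDecay hT ht
  have hUpres : PreservesDecay v t U := by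
    have := PreservesDecay.one.add (hTdecay.smul (-(α : 𝕜)))
    rwa [neg_smul, ← sub_eq_add_neg] at this
  refine ⟨(α : 𝕜) • (h * ∑' n, (catalan n : 𝕜) • (X * T) ^ n), ?_,
    ((PreservesDecay.sum (fun i => hUpres.pow i) n).mul hFdecay).smul _⟩
  rw [mul_smul_comm, ← mul_assoc, ← smul_mul_assoc, ← smul_mul_assoc, hgeom', hF]

end Localized

/-! ### Gram matrices and stability of the sampled operator -/

section Stability

variable {𝕜 H : Type*} [RCLike 𝕜] [NormedAddCommGroup H] [InnerProductSpace 𝕜 H]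

/-- The lower Rayleigh bound for a Gram matrix, as a lower Riesz bound for its vectors. -/
theorem lambdaMin_mul_le (φ : ℕ → H) (I : Finset ℕ) (a : I → 𝕜) :
    lambdaMin 𝕜 φ I * ∑ i, ‖a i‖ ^ 2 ≤ ‖∑ i, a i • φ i‖ ^ 2 := by
  have hM := isHermitian_gramOn (𝕜 := 𝕜) φ I
  set b := hM.eigenvectorBasis with hb
  set x : EuclideanSpace 𝕜 I := WithLp.toLp 2 a with hx
  have hsym := Matrix.isSymmetric_toEuclideanLin_iff.mpr hM
  have happly : ∀ i, Matrix.toEuclideanLin (gramOn 𝕜 φ I) (b i) =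
      ((hM.eigenvalues i : ℝ) : 𝕜) • b i := by
    intro i
    ext k
    have := congrFun (hM.mulVec_eigenvectorBasis i) k
    simpa [Matrix.toLpLin_apply, RCLike.real_smul_eq_coe_mul] using this
  have hquad : inner 𝕜 x (Matrix.toEuclideanLin (gramOn 𝕜 φ I) x) =
      ((∑ i, hM.eigenvalues i * ‖inner 𝕜 (b i) x‖ ^ 2 : ℝ) : 𝕜) := by
    rw [← b.sum_inner_mul_inner, RCLike.ofReal_sum]
    refine Finset.sum_congr rfl fun i _ => ?_
    rw [← hsym, happly, inner_smul_left, RCLike.conj_ofReal, ← inner_conj_symm x,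
      mul_left_comm, RCLike.conj_mul]
    push_cast
    rfl
  have hnorm : inner 𝕜 x (Matrix.toEuclideanLin (gramOn 𝕜 φ I) x) =
      ((‖∑ i, a i • φ i‖ ^ 2 : ℝ) : 𝕜) := by
    rw [EuclideanSpace.inner_eq_star_dotProduct, Matrix.ofLp_toLpLin, Matrix.toLin'_apply,
      dotProduct_comm]
    refine (Matrix.star_dotProduct_gram_mulVec (fun i : I => φ i) a a).trans ?_
    rw [inner_self_eq_norm_sq_to_K, RCLike.ofReal_pow]
  have hsq : ∑ i, ‖a i‖ ^ 2 = ∑ i, ‖inner 𝕜 (b i) x‖ ^ 2 := by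
    rw [b.sum_sq_norm_inner_right, EuclideanSpace.norm_sq_eq]
  have heq : ‖∑ i, a i • φ i‖ ^ 2 = ∑ i, hM.eigenvalues i * ‖inner 𝕜 (b i) x‖ ^ 2 := by
    exact_mod_cast hnorm.symm.trans hquad
  rw [heq, hsq, Finset.mul_sum]
  gcongr with i
  exact ciInf_le (Set.finite_range _).bddBelow i

namespace IsGramBasis

variable {φ : ℕ → H} {n : ℕ} {I : Finset ℕ} (hI : IsGramBasis 𝕜 φ n I)
include hI

theorem lambdaMin_pos : 0 < lambdaMin 𝕜 φ I := by
  have : Nonempty I := hI.1.to_subtype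
  have hpos := ((Matrix.posSemidef_gram 𝕜 fun i : I => φ i).posDef_iff_isUnit).2 hI.2.2.1
  obtain ⟨i, hi⟩ := exists_eq_ciInf_of_finite
    (f := fun i => (isHermitian_gramOn (𝕜 := 𝕜) φ I).eigenvalues i)
  rw [lambdaMin, ← hi]
  exact hpos.eigenvalues_pos i

theorem exists_coeff {g : H} (hg : g ∈ G 𝕜 φ n) : ∃ a : I → 𝕜, ∑ i, a i • φ i = g := by
  rw [← hI.2.2.2, Set.image_eq_range] at hg
  exact (Submodule.mem_span_range_iff_exists_fun 𝕜).1 hg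

theorem nontrivial : Nontrivial H := by
  by_contra h
  rw [not_nontrivial_iff_subsingleton] at h
  have h1 := lambdaMin_mul_le (𝕜 := 𝕜) φ I fun _ => 1
  have h2 := hI.lambdaMin_pos
  have : Nonempty I := hI.1.to_subtype
  rw [Subsingleton.elim (∑ i : I, (1 : 𝕜) • φ i) 0] at h1
  have h3 : 0 < lambdaMin 𝕜 φ I * ∑ _i : I, ‖(1 : 𝕜)‖ ^ 2 :=
    mul_pos h2 (Finset.sum_pos (fun _ _ => by simp) Finset.univ_nonempty)
  simp only [norm_zero] at h1
  linarith

end IsGramBasis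

variable {ψ φ : ℕ → H} {A B c₁ s : ℝ} {n m : ℕ} {I : Finset ℕ}

/-- What the choice of `m` gives. Rounding down is harmless because indices start at `0`: the first
omitted index is `m`, at distance at least `m - n + 1` from the indices below `n`. -/
theorem le_of_floor_sampleNumber_le (hA : 0 < A) (hs : 1 / 2 < s) (hI : IsGramBasis 𝕜 φ n I)
    (hm : ⌊sampleNumber 𝕜 φ I A c₁ s n⌋₊ ≤ m) :
    n ≤ m ∧ n * c₁ ^ 2 * (((m : ℝ) - n + 1) ^ (1 - 2 * s) / (2 * s - 1)) ≤
      A / 2 * lambdaMin 𝕜 φ I := by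
  have hl := hI.lambdaMin_pos
  have hs' : 0 < 2 * s - 1 := by linarith
  set b := 2 * c₁ ^ 2 * n / (A * (2 * s - 1) * lambdaMin 𝕜 φ I) with hb
  have hb0 : 0 ≤ b := by positivity
  have hr : 0 ≤ b ^ (1 / (2 * s - 1)) := by positivity
  have hlt : (n : ℝ) + b ^ (1 / (2 * s - 1)) < m + 1 := by
    have h1 := Nat.lt_floor_add_one (sampleNumber 𝕜 φ I A c₁ s n)
    have h2 : (⌊sampleNumber 𝕜 φ I A c₁ s n⌋₊ : ℝ) ≤ m := by exact_mod_cast hm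
    exact h1.trans_le (by linarith)
  have hnm : n ≤ m := by
    have : (n : ℝ) < (m + 1 : ℕ) := by push_cast; linarith
    have : n < m + 1 := by exact_mod_cast this
    omega
  refine ⟨hnm, ?_⟩
  have hx : b ^ (1 / (2 * s - 1)) ≤ (m : ℝ) - n + 1 := by linarith
  have hx0 : (0 : ℝ) < m - n + 1 := by
    have : (n : ℝ) ≤ m := by exact_mod_cast hnm
    linarith
  have hbx : b ≤ ((m : ℝ) - n + 1) ^ (2 * s - 1) := by
    calc b = (b ^ (1 / (2 * s - 1))) ^ (2 * s - 1) := by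
          rw [← Real.rpow_mul hb0, one_div_mul_cancel hs'.ne', Real.rpow_one]
      _ ≤ _ := by gcongr
  rw [show 1 - 2 * s = -(2 * s - 1) by ring, Real.rpow_neg hx0.le]
  set y := ((m : ℝ) - n + 1) ^ (2 * s - 1) with hy
  have hy0 : 0 < y := by positivity
  rw [hb, div_le_iff₀ (by positivity)] at hbx
  calc n * c₁ ^ 2 * (y⁻¹ / (2 * s - 1)) = 2 * c₁ ^ 2 * n / (2 * y * (2 * s - 1)) := by
        field_simp
    _ ≤ y * (A * (2 * s - 1) * lambdaMin 𝕜 φ I) / (2 * y * (2 * s - 1)) := by gcongr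
    _ = A / 2 * lambdaMin 𝕜 φ I := by field_simp

/-- A single frame coefficient, beyond the section, of a linear combination of localized vectors. -/
theorem norm_inner_sq_le (hs : 0 ≤ s) (hmix : IsLocalized 𝕜 ψ φ c₁ s)
    (hI : I ⊆ Finset.range n) (hnm : n ≤ m) (a : I → 𝕜) (j : ℕ) :
    ‖inner 𝕜 (ψ (j + m)) (∑ i, a i • φ i)‖ ^ 2 ≤
      (∑ i, ‖a i‖ ^ 2) * (n * c₁ ^ 2 * ((m : ℝ) - n + 1 + (j + 1 : ℕ)) ^ (-(2 * s))) := by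
  have hnm' : (n : ℝ) ≤ m := by exact_mod_cast hnm
  set r : ℝ := (m : ℝ) - n + 1 + (j + 1 : ℕ) with hr
  have hr0 : 0 < r := by rw [hr]; push_cast; have := Nat.cast_nonneg (α := ℝ) j; linarith
  have hc : 0 ≤ c₁ := nonneg_of_mul_nonneg_left ((norm_nonneg _).trans (hmix 0 0)) (by simp)
  have hentry : ∀ i : I, ‖inner 𝕜 (ψ (j + m)) (φ i)‖ ≤ c₁ * r ^ (-s) := by
    intro i
    rw [norm_inner_symm]
    refine (hmix _ _).trans ?_
    gcongr ?_ * ?_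
    refine Real.rpow_le_rpow_of_nonpos hr0 ?_ (by linarith)
    have hin : (i : ℕ) + 1 ≤ n := Finset.mem_range.1 (hI i.2)
    have hin' : ((i : ℕ) : ℝ) + 1 ≤ n := by exact_mod_cast hin
    have := le_abs_self (((j + m : ℕ) : ℝ) - (i : ℕ))
    rw [hr]
    push_cast at this ⊢
    linarith
  have hcard : (Fintype.card I : ℝ) ≤ n := by
    have := Finset.card_le_card hI
    rw [Finset.card_range] at this
    rw [Fintype.card_coe]
    exact_mod_cast this
  calc ‖inner 𝕜 (ψ (j + m)) (∑ i, a i • φ i)‖ ^ 2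
      ≤ (∑ i, ‖a i‖ * ‖inner 𝕜 (ψ (j + m)) (φ i)‖) ^ 2 := by
        gcongr
        rw [inner_sum]
        refine (norm_sum_le _ _).trans (le_of_eq ?_)
        simp_rw [inner_smul_right, norm_mul]
    _ ≤ (∑ i, ‖a i‖ ^ 2) * ∑ i : I, ‖inner 𝕜 (ψ (j + m)) (φ i)‖ ^ 2 :=
        Finset.sum_mul_sq_le_sq_mul_sq _ _ _
    _ ≤ (∑ i, ‖a i‖ ^ 2) * ∑ _i : I, (c₁ * r ^ (-s)) ^ 2 := by
        gcongr with i
        exact hentry i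
    _ = (∑ i, ‖a i‖ ^ 2) * (Fintype.card I * c₁ ^ 2 * r ^ (-(2 * s))) := by
        rw [Finset.sum_const, Finset.card_univ, nsmul_eq_mul, mul_pow, ← Real.rpow_natCast (_ ^ _),
          ← Real.rpow_mul hr0.le]
        ring_nf
    _ ≤ _ := by gcongr

/-- On `G_n`, the first `m` frame coefficients carry at least half of the lower frame bound. -/
theorem half_lower_bound (hψ : IsFrame 𝕜 ψ A B) (hs : 1 / 2 < s)
    (hmix : IsLocalized 𝕜 ψ φ c₁ s) (hI : IsGramBasis 𝕜 φ n I)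
    (hm : ⌊sampleNumber 𝕜 φ I A c₁ s n⌋₊ ≤ m) {g : H} (hg : g ∈ G 𝕜 φ n) :
    A / 2 * ‖g‖ ^ 2 ≤ ∑ j ∈ Finset.range m, ‖inner 𝕜 (ψ j) g‖ ^ 2 := by
  obtain ⟨hnm, hnum⟩ := le_of_floor_sampleNumber_le hψ.1 hs hI hm
  obtain ⟨a, rfl⟩ := hI.exists_coeff hg
  set g := ∑ i, a i • φ i
  have hgram := lambdaMin_mul_le φ I a
  have hx0 : (0 : ℝ) < m - n + 1 := by
    have : (n : ℝ) ≤ m := by exact_mod_cast hnm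
    linarith
  have ha : 0 ≤ ∑ i, ‖a i‖ ^ 2 := Finset.sum_nonneg fun _ _ => by positivity
  have hsum := summable_rpow_neg hx0 (show 1 < 2 * s by linarith)
  have htail : ∑' j, ‖inner 𝕜 (ψ (j + m)) g‖ ^ 2 ≤ A / 2 * ‖g‖ ^ 2 := by
    calc ∑' j, ‖inner 𝕜 (ψ (j + m)) g‖ ^ 2
        ≤ ∑' j : ℕ, (∑ i, ‖a i‖ ^ 2) *
          (n * c₁ ^ 2 * ((m : ℝ) - n + 1 + (j + 1 : ℕ)) ^ (-(2 * s))) :=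
          ((summable_nat_add_iff m).2 (hψ.2.2 g).1).tsum_le_tsum
            (norm_inner_sq_le (by linarith) hmix hI.2.1 hnm a) ((hsum.mul_left _).mul_left _)
      _ = (∑ i, ‖a i‖ ^ 2) *
          (n * c₁ ^ 2 * ∑' j : ℕ, ((m : ℝ) - n + 1 + (j + 1 : ℕ)) ^ (-(2 * s))) := by
          rw [tsum_mul_left, tsum_mul_left]
      _ ≤ (∑ i, ‖a i‖ ^ 2) *
          (n * c₁ ^ 2 * (((m : ℝ) - n + 1) ^ (1 - 2 * s) / (2 * s - 1))) := by
          gcongr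
          exact tsum_rpow_neg_le hx0 (by linarith)
      _ ≤ (∑ i, ‖a i‖ ^ 2) * (A / 2 * lambdaMin 𝕜 φ I) := by gcongr
      _ = A / 2 * (lambdaMin 𝕜 φ I * ∑ i, ‖a i‖ ^ 2) := by ring
      _ ≤ A / 2 * ‖g‖ ^ 2 := by
          have := hψ.1
          gcongr
  have hsplit := (hψ.2.2 g).1.sum_add_tsum_nat_add m
  have hlow := (hψ.2.2 g).2.1
  linarith

theorem inner_W_self (g : G 𝕜 φ n) :
    inner 𝕜 g (W 𝕜 ψ φ n m g) =
      ((∑ j ∈ Finset.range m, ‖inner 𝕜 (ψ j) (g : H)‖ ^ 2 : ℝ) : 𝕜) := by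
  rw [← inner_S_self]
  exact Submodule.inner_orthogonalProjectionOnto_eq_of_mem_left g _

/-- A coercive operator on a finite-dimensional space is invertible, with the expected bound. -/
theorem isInvertible_of_coercive {V : Type*} [NormedAddCommGroup V] [InnerProductSpace 𝕜 V]
    [FiniteDimensional 𝕜 V] (P : V →L[𝕜] V) {a : ℝ} (ha : 0 < a)
    (hP : ∀ x, a * ‖x‖ ^ 2 ≤ RCLike.re (inner 𝕜 x (P x))) :
    P.IsInvertible ∧ ‖P.inverse‖ ≤ a⁻¹ := by
  have hlow : ∀ x, a * ‖x‖ ≤ ‖P x‖ := by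
    intro x
    by_cases hx : x = 0
    · simp [hx]
    have h0 : 0 < ‖x‖ := norm_pos_iff.2 hx
    have h1 := (hP x).trans ((RCLike.re_le_norm _).trans (norm_inner_le_norm x (P x)))
    nlinarith
  have hinj : Function.Injective P := by
    refine (injective_iff_map_eq_zero P).2 fun x hx => ?_
    have := hlow x
    rw [hx, norm_zero] at this
    exact norm_le_zero_iff.1 (nonpos_of_mul_nonpos_right this ha)
  have hinv : P.IsInvertible :=
    ⟨(LinearEquiv.ofInjectiveEndo (P : V →ₗ[𝕜] V) hinj).toContinuousLinearEquiv, by ext x; rfl⟩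
  refine ⟨hinv, ContinuousLinearMap.opNorm_le_bound _ (by positivity) fun y => ?_⟩
  have h1 := hlow (P.inverse y)
  rw [hinv.self_apply_inverse] at h1
  rwa [inv_mul_eq_div, le_div_iff₀' ha]

theorem W_isInvertible (hψ : IsFrame 𝕜 ψ A B) (hs : 1 / 2 < s)
    (hmix : IsLocalized 𝕜 ψ φ c₁ s) (hI : IsGramBasis 𝕜 φ n I)
    (hm : ⌊sampleNumber 𝕜 φ I A c₁ s n⌋₊ ≤ m) :
    (W 𝕜 ψ φ n m).IsInvertible ∧ ‖(W 𝕜 ψ φ n m).inverse‖ ≤ 2 / A := by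
  have := isInvertible_of_coercive (W 𝕜 ψ φ n m) (half_pos hψ.1) fun g => by
    rw [inner_W_self, RCLike.ofReal_re]
    exact half_lower_bound hψ hs hmix hI hm g.2
  rwa [inv_div] at this

/-! ### Approximation from the reconstruction spaces -/

/-- The reconstruction is quasi-optimal: it reproduces `G_n` and is bounded on `H`. -/
theorem norm_sub_recon_le (hψ : IsFrame 𝕜 ψ A B) (hW : (W 𝕜 ψ φ n m).IsInvertible)
    (hWn : ‖(W 𝕜 ψ φ n m).inverse‖ ≤ 2 / A) (f : H) {g : H} (hg : g ∈ G 𝕜 φ n) :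
    ‖f - recon 𝕜 ψ φ n m f‖ ≤ (1 + 2 / A * B) * ‖f - g‖ := by
  have hA := hψ.1
  have hrec : recon 𝕜 ψ φ n m g = g := by
    have := hW.inverse_apply_self ⟨g, hg⟩
    exact congrArg Subtype.val this
  have hsub : f - recon 𝕜 ψ φ n m f = (f - g) - recon 𝕜 ψ φ n m (f - g) := by
    have : recon 𝕜 ψ φ n m (f - g) = recon 𝕜 ψ φ n m f - recon 𝕜 ψ φ n m g := by
      simp [recon]
    rw [this, hrec]
    abel
  have hbound : ‖recon 𝕜 ψ φ n m (f - g)‖ ≤ 2 / A * (B * ‖f - g‖) := by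
    refine ((W 𝕜 ψ φ n m).inverse.le_of_opNorm_le hWn _).trans ?_
    gcongr
    exact (Submodule.norm_orthogonalProjectionOnto_apply_le _ _).trans
      ((S 𝕜 ψ m).le_of_opNorm_le (hψ.norm_S_le m) _)
  rw [hsub]
  refine (norm_sub_le _ _).trans ?_
  linarith

theorem S_apply_mem (n : ℕ) (g : H) : S 𝕜 φ n g ∈ G 𝕜 φ n := by
  rw [S_apply]
  exact Submodule.sum_mem _ fun j hj => Submodule.smul_mem _ _
    (Submodule.subset_span ⟨j, Finset.mem_range.1 hj, rfl⟩)

/-- Truncating the frame expansion costs at most the `ℓ²` tail of the coefficients. -/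
theorem norm_frameOperator_sub_S_le {T : H →L[𝕜] H} (hT : IsFrameOperator 𝕜 φ T)
    (hφ : IsFrame 𝕜 φ A B) (g : H) {d : ℝ} (hd : 0 ≤ d)
    (htail : ∀ u : Finset ℕ, ∑ k ∈ u, ‖inner 𝕜 (φ (k + n)) g‖ ^ 2 ≤ d ^ 2) :
    ‖T g - S 𝕜 φ n g‖ ≤ √B * d := by
  refine norm_le_of_forall_inner (𝕜 := 𝕜) (by positivity) fun x => ?_
  have h1 := (hasSum_nat_add_iff' n).2 (hT x g)
  have h2 : inner 𝕜 x (T g - S 𝕜 φ n g) =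
      inner 𝕜 x (T g) - ∑ k ∈ Finset.range n, inner 𝕜 x (φ k) * inner 𝕜 (φ k) g := by
    rw [inner_sub_right, S_apply, inner_sum]
    simp_rw [inner_smul_right, mul_comm]
  rw [h2]
  refine le_of_tendsto h1.norm (Filter.Eventually.of_forall fun u => ?_)
  have hx : ∑ k ∈ u, ‖inner 𝕜 (φ (k + n)) x‖ ^ 2 ≤ B * ‖x‖ ^ 2 := by
    have hsx := (hφ.2.2 x).1
    calc _ ≤ ∑' k, ‖inner 𝕜 (φ (k + n)) x‖ ^ 2 :=
          ((summable_nat_add_iff n).2 hsx).sum_le_tsum _ fun _ _ => by positivity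
      _ ≤ ∑' k, ‖inner 𝕜 (φ k) x‖ ^ 2 := by
          rw [← hsx.sum_add_tsum_nat_add n]
          exact le_add_of_nonneg_left (Finset.sum_nonneg fun _ _ => by positivity)
      _ ≤ _ := (hφ.2.2 x).2.2
  calc _ ≤ ∑ k ∈ u, ‖inner 𝕜 (φ (k + n)) x‖ * ‖inner 𝕜 (φ (k + n)) g‖ := by
        refine (norm_sum_le _ _).trans (le_of_eq (Finset.sum_congr rfl fun k _ => ?_))
        rw [norm_mul, norm_inner_symm x]
    _ ≤ √(∑ k ∈ u, ‖inner 𝕜 (φ (k + n)) x‖ ^ 2) * √(∑ k ∈ u, ‖inner 𝕜 (φ (k + n)) g‖ ^ 2) :=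
        Real.sum_mul_le_sqrt_mul_sqrt _ _ _
    _ ≤ √(B * ‖x‖ ^ 2) * √(d ^ 2) := by
        gcongr
        exact htail u
    _ = √B * d * ‖x‖ := by
        rw [Real.sqrt_mul hφ.2.1.le, Real.sqrt_sq (norm_nonneg x), Real.sqrt_sq hd]
        ring

theorem CoeffDecay.sum_tail_le {t c : ℝ} {g : H} (ht : 1 < t) (h : CoeffDecay 𝕜 φ t g c)
    (hn : 1 ≤ n) (u : Finset ℕ) :
    ∑ k ∈ u, ‖inner 𝕜 (φ (k + n)) g‖ ^ 2 ≤ (c * (n : ℝ) ^ (-(t - 1 / 2))) ^ 2 := by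
  have hn0 : (0 : ℝ) < n := by exact_mod_cast hn
  have h2t : 1 < 2 * t := by linarith
  have hsum := summable_rpow_neg hn0 h2t
  calc ∑ k ∈ u, ‖inner 𝕜 (φ (k + n)) g‖ ^ 2
      ≤ ∑ k ∈ u, c ^ 2 * ((n : ℝ) + (k + 1 : ℕ)) ^ (-(2 * t)) := by
        gcongr with k
        have h1 := h (k + n)
        rw [decay_zero_right] at h1
        calc _ ≤ (c * (((k + n : ℕ) : ℝ) + 1) ^ (-t)) ^ 2 := by gcongr
          _ = c ^ 2 * (((k + n : ℕ) : ℝ) + 1) ^ (-(2 * t)) := by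
            rw [mul_pow, ← Real.rpow_natCast (_ ^ _), ← Real.rpow_mul (by positivity)]
            ring_nf
          _ = _ := by push_cast; ring_nf
    _ = c ^ 2 * ∑ k ∈ u, ((n : ℝ) + (k + 1 : ℕ)) ^ (-(2 * t)) := by rw [Finset.mul_sum]
    _ ≤ c ^ 2 * ((n : ℝ) ^ (1 - 2 * t) / (2 * t - 1)) := by
        gcongr
        exact (hsum.sum_le_tsum _ fun _ _ => by positivity).trans (tsum_rpow_neg_le hn0 h2t)
    _ ≤ c ^ 2 * (n : ℝ) ^ (1 - 2 * t) := by
        gcongr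
        exact div_le_self (by positivity) (by linarith)
    _ = _ := by
        rw [mul_pow, ← Real.rpow_natCast (_ ^ _), ← Real.rpow_mul hn0.le]
        ring_nf

/-- For a self-localized frame, coefficients of decay `t` give the rate `t - 1 / 2` of
approximation from the spaces `G_n`. -/
theorem exists_approximation [CompleteSpace H] [Nontrivial H] (hφ : IsFrame 𝕜 φ A B) {c₀ t : ℝ}
    (ht : 1 < t) (hloc : IsLocalized 𝕜 φ φ c₀ t) :
    ∃ D : ℝ, 0 ≤ D ∧ ∀ f c, CoeffDecay 𝕜 φ t f c → ∀ n : ℕ, 1 ≤ n →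
      ∃ g ∈ G 𝕜 φ n, ‖f - g‖ ≤ D * c * (n : ℝ) ^ (-(t - 1 / 2)) := by
  obtain ⟨T, hT⟩ := hφ.exists_isFrameOperator
  have hone : MatrixDecay φ t (1 : H →L[𝕜] H) c₀ := fun j l => by
    rw [decay_comm]
    exact hloc l j
  obtain ⟨R, hTR, C, hC, hR⟩ := exists_inverse_preservesDecay hT hφ ht hone
  refine ⟨√B * C, by positivity, fun f c hf n hn => ⟨S 𝕜 φ n (R f), S_apply_mem n _, ?_⟩⟩
  have hc := hf.nonneg
  have h1 : T (R f) = f := congrArg (fun P : H →L[𝕜] H => P f) hTR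
  have h2 := norm_frameOperator_sub_S_le (n := n) hT hφ (R f)
    (d := C * c * (n : ℝ) ^ (-(t - 1 / 2))) (by positivity)
    fun u => (hR f c hf).sum_tail_le ht hn u
  rw [h1] at h2
  exact h2.trans_eq (by ring)

end Stability

end FrameRec

theorem theorem5p1 {𝕜 H : Type*} [RCLike 𝕜] [NormedAddCommGroup H] [InnerProductSpace 𝕜 H]
    [CompleteSpace H] (ψ φ : ℕ → H) (A B A' B' c₁ s : ℝ)
    (hψ : FrameRec.IsFrame 𝕜 ψ A B) (hφ : FrameRec.IsFrame 𝕜 φ A' B')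
    (hs : 1 / 2 < s) (hmix : FrameRec.IsLocalized 𝕜 ψ φ c₁ s) :
    (∀ (n : ℕ) (I : Finset ℕ) (m : ℕ), 1 ≤ n → FrameRec.IsGramBasis 𝕜 φ n I →
      ⌊FrameRec.sampleNumber 𝕜 φ I A c₁ s n⌋₊ ≤ m →
        (FrameRec.W 𝕜 ψ φ n m).IsInvertible ∧
          ‖(FrameRec.W 𝕜 ψ φ n m).inverse‖ ≤ 2 / A) ∧
    (∀ c₀ t : ℝ, 1 < t → FrameRec.IsLocalized 𝕜 φ φ c₀ t → ∀ c₂ : ℝ, 0 < c₂ →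
      ∃ c : ℝ, 0 < c ∧ ∀ f : H,
        (∀ j : ℕ, ‖inner 𝕜 (φ j) f‖ ≤ c₂ * ((j : ℝ) + 1) ^ (-t)) →
        ∀ (n : ℕ) (I : Finset ℕ) (m : ℕ), 1 ≤ n → FrameRec.IsGramBasis 𝕜 φ n I →
          ⌊FrameRec.sampleNumber 𝕜 φ I A c₁ s n⌋₊ ≤ m →
            ‖f - FrameRec.recon 𝕜 ψ φ n m f‖ ≤ c * (n : ℝ) ^ (-(t - 1 / 2))) := by
  refine ⟨fun n I m _ hI hm => FrameRec.W_isInvertible hψ hs hmix hI hm, ?_⟩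
  intro c₀ t ht hloc c₂ hc₂
  have hA := hψ.1
  have hB := hψ.2.1
  rcases subsingleton_or_nontrivial H with hH | hH
  -- In the zero space there is no nonempty set of indices with invertible Gram matrix.
  · exact ⟨1, one_pos, fun f _ n I m _ hI _ =>
      absurd hI.nontrivial (not_nontrivial_iff_subsingleton.2 hH)⟩
  obtain ⟨D, hD, happrox⟩ := FrameRec.exists_approximation hφ ht hloc
  -- The summand `1` only serves to make the constant positive.
  refine ⟨(1 + 2 / A * B) * (D * c₂) + 1, by positivity, fun f hf n I m hn hI hm => ?_⟩
  have hf' : FrameRec.CoeffDecay 𝕜 φ t f c₂ := fun j => by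
    rw [FrameRec.decay_zero_right]
    exact hf j
  obtain ⟨g, hg, hfg⟩ := happrox f c₂ hf' n hn
  obtain ⟨hW, hWn⟩ := FrameRec.W_isInvertible hψ hs hmix hI hm
  have hn0 : 0 ≤ (n : ℝ) ^ (-(t - 1 / 2)) := by positivity
  calc ‖f - FrameRec.recon 𝕜 ψ φ n m f‖ ≤ (1 + 2 / A * B) * ‖f - g‖ :=
        FrameRec.norm_sub_recon_le hψ hW hWn f hg
    _ ≤ (1 + 2 / A * B) * (D * c₂ * (n : ℝ) ^ (-(t - 1 / 2))) := by gcongr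
    _ ≤ _ := by linarith
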